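/- **Theorem.** Consider Set Cover inputs with $n$ elements and $m$ sets, accessed only through the adjacency-list oracles $\mathrm{EltOf}(S,j)$ (the $j$-th element of the set $S$, or $\bot$ if $|S|<j$) and $\mathrm{SetOf}(e,j)$ (the $j$-th set containing the element $e$, or $\bot$ if $e$ lies in fewer than $j$ sets); the lists may be in any order. There is an absolute constant $p\in\mathbb N$ such that for every $C>0$ there is $c>0$ with the following property. Let $m\ge n$, $k\ge 2$ with $1.02\,k\le n$ and $k\le C\,m/\log n$, and let $\alpha\le 1.01$. Let $\mathcal A$ be any randomized adaptive query algorithm which, on every input with $n$ elements, $m$ sets and minimum set cover size exactly $k$, returns with probability at least $0.99$ a set cover of size at most $\alpha k$. Then there is an input with $n$ elements, $m$ sets and minimum set cover size $k$ on which $\mathcal A$ makes, with positive probability, at least $$c\cdot\frac{mn}{k\,(\log (mn))^{p}}$$ oracle queries. That is, for $k=O(m/\log n)$ computing an $\alpha$-approximate set cover with success probability $0.99$ requires $\tilde\Omega(mn/k)$ queries. -/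

import Mathlib

/-- A Set Cover input with elements `Fin n` and sets `Fin m`, presented by adjacency lists:
`elts s` lists the elements of the set `s`, `sets e` lists the sets containing the element `e`,
each without repetition and in an arbitrary order. -/
structure SetCoverInstance (n m : ℕ) where
  elts : Fin m → List (Fin n)
  sets : Fin n → List (Fin m)
  nodup_elts : ∀ s, (elts s).Nodup
  nodup_sets : ∀ e, (sets e).Nodup
  mem_iff : ∀ s e, e ∈ elts s ↔ s ∈ sets e

namespace SetCoverInstance

variable {n m : ℕ}

/-- The oracle EltOf: the element in position `j` (counted from `0`) of the set `s`, and `none`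
(that is, ⊥) if `s` has at most `j` elements. -/
def eltOf (I : SetCoverInstance n m) (s : Fin m) (j : ℕ) : Option (Fin n) := (I.elts s)[j]?

/-- The oracle SetOf: the set in position `j` (counted from `0`) among those containing `e`, and
`none` (that is, ⊥) if `e` lies in at most `j` sets. -/
def setOf (I : SetCoverInstance n m) (e : Fin n) (j : ℕ) : Option (Fin m) := (I.sets e)[j]?

/-- The chosen sets cover all the elements. -/
def IsCover (I : SetCoverInstance n m) (D : Finset (Fin m)) : Prop :=
  ∀ e : Fin n, ∃ s ∈ D, e ∈ I.elts s

/-- The minimum size of a set cover is `k` (in particular a cover exists). -/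
def HasOpt (I : SetCoverInstance n m) (k : ℕ) : Prop :=
  IsLeast {c : ℕ | ∃ D : Finset (Fin m), I.IsCover D ∧ D.card = c} k

/-- `D` is an `α`-approximate set cover: a cover whose size is at most `α` times that of
every cover. -/
def IsApproxCover (I : SetCoverInstance n m) (α : ℝ) (D : Finset (Fin m)) : Prop :=
  I.IsCover D ∧ ∀ D' : Finset (Fin m), I.IsCover D' → (D.card : ℝ) ≤ α * (D'.card : ℝ)

end SetCoverInstance

/-- A deterministic adaptive query algorithm for inputs with `n` elements and `m` sets, as a
decision tree: it either stops and returns a collection of sets, or makes an oracle query and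
continues depending on the answer. -/
inductive QueryAlg (n m : ℕ) : Type where
  | output (D : Finset (Fin m)) : QueryAlg n m
  | askElt (s : Fin m) (j : ℕ) (next : Option (Fin n) → QueryAlg n m) : QueryAlg n m
  | askSet (e : Fin n) (j : ℕ) (next : Option (Fin m) → QueryAlg n m) : QueryAlg n m

namespace QueryAlg

variable {n m : ℕ}

/-- The collection of sets returned on the input `I`. -/
def run (I : SetCoverInstance n m) : QueryAlg n m → Finset (Fin m)
  | output D => D
  | askElt s j next => run I (next (I.eltOf s j))
  | askSet e j next => run I (next (I.setOf e j))

/-- The number of oracle queries made on the input `I`. -/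
def queries (I : SetCoverInstance n m) : QueryAlg n m → ℕ
  | output _ => 0
  | askElt s j next => queries I (next (I.eltOf s j)) + 1
  | askSet e j next => queries I (next (I.setOf e j)) + 1

end QueryAlg

/-- A randomized query algorithm: a probability distribution over deterministic ones. (There are
only countably many decision trees, so every distribution over them is of this form.) -/
abbrev RandQueryAlg (n m : ℕ) : Type := PMF (QueryAlg n m)

namespace RandQueryAlg

variable {n m : ℕ}

/-- The probability that the randomized algorithm returns an `α`-approximate cover of `I`. -/
noncomputable def successProb (A : RandQueryAlg n m) (α : ℝ) (I : SetCoverInstance n m) :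
    ENNReal :=
  PMF.toOuterMeasure A {T | I.IsApproxCover α (T.run I)}

/-- The randomized algorithm makes at least `q` queries on `I` for some outcome of its random
choices that has positive probability. -/
def RequiresQueries (A : RandQueryAlg n m) (I : SetCoverInstance n m) (q : ℝ) : Prop :=
  ∃ T ∈ PMF.support A, q ≤ (T.queries I : ℝ)

end RandQueryAlg

/-!
The bound holds without logarithmic factors, so the exponent `p = 0` serves.

The hard inputs are disjoint unions of `b ≥ k / 50` copies of a *gadget*, completed by `k - b` static
sets that are forced into every cover. A gadget has one default member, in which no set contains the
whole core, and one member for each secret `y`, in which exactly one set, the special set of `y`, does.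
So with a secret in every block the optimum is `k`, and a cover pays one extra set for each block in
which it does not identify the special set (`Gadget.le_card_of_isCover`); an approximation within
`1.01` identifies it in at least half of the blocks. A gadget hides its secret with parameter `R` if
each list entry differs from the default one for at most a fraction `1 / R` of the secrets.

Fix a deterministic algorithm and a block `i`, and resample only the secret of `i`. As long as the
queries inside the block return default entries, the run is the one for the default member, and its
output cannot depend on the secret; `τ` queries in the block leave this run with probability at most
`τ / R` (`QueryAlg.card_run_ne_le`). If `q` queries are made in total, at most `q / (τ + 1)` blocks
receive more than `τ` of them. So with `q = b R / 100` and `τ ≈ R / 10` few special sets are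
identified on average (`Gadget.IsHiding.sum_card_identified_le`), and averaging over the inputs
transfers this to randomized algorithms (`exists_requiresQueries`).

Two gadgets provide `R` of order `m n / k²` when `m ≥ 800 k`. For `n < 4 k`, where there is hardly a
spare element, `moveGadget` has only two core elements and changes the sizes of two sets, which is
hidden well enough by the number of sets. For `n ≥ 4 k`, `swapGadget` exchanges two incidences by
means of padding elements, so that all lists keep their lengths, as in the swaps of a median instance;
but each set misses a single core element, which makes one exchange suffice and the base input
explicit.

If `m < 800 k`, the hypothesis `k ≤ C m / log n` bounds `n`, hence also `m n / k`, in terms of `C`, and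
only a single query has to be forced: no fixed output serves all cyclic shifts of a partition into `k`
sets (`card_isCover_shiftedPartition_le`).
-/

/-! ### From distributions over inputs to randomized algorithms -/

/-- The averaging half of Yao's principle: if every deterministic algorithm that is fast on a finite
family of inputs fails on a fixed proportion of it, then a randomized algorithm that is reliable on
the whole family must be slow on one of its members. -/
theorem exists_requiresQueries {n m : ℕ} {ι : Type*} [Fintype ι] [Nonempty ι]
    (A : RandQueryAlg n m) (α q : ℝ) (J : ι → SetCoverInstance n m)
    (hA : ∀ i, 99 / 100 ≤ A.successProb α (J i))
    (hT : ∀ T : QueryAlg n m, (∀ i, (T.queries (J i) : ℝ) < q) →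
      100 * Nat.card {i // (J i).IsApproxCover α (T.run (J i))} ≤ 98 * Fintype.card ι) :
    ∃ i, A.RequiresQueries (J i) q := by
  classical
  by_contra! hcon
  have hq : ∀ T ∈ A.support, ∀ i, (T.queries (J i) : ℝ) < q := by
    intro T hTs i
    by_contra! h
    exact hcon i ⟨T, hTs, h⟩
  have key : ∑ i, A.successProb α (J i) ≤ (98 / 100 : ENNReal) * Fintype.card ι := by
    have h1 : ∀ T, ∑ i, Set.indicator {T | (J i).IsApproxCover α (T.run (J i))} A T
        ≤ A T * ((98 / 100 : ENNReal) * Fintype.card ι) := by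
      intro T
      by_cases hTs : T ∈ A.support
      · have h2 := hT T (hq T hTs)
        have h3 : ∑ i, Set.indicator {T | (J i).IsApproxCover α (T.run (J i))} A T
            = A T * (Nat.card {i // (J i).IsApproxCover α (T.run (J i))} : ENNReal) := by
          rw [Nat.card_eq_fintype_card, Fintype.card_subtype, Finset.card_filter]
          push_cast
          rw [Finset.mul_sum]
          refine Finset.sum_congr rfl fun i _ => ?_
          simp [Set.indicator_apply]
        rw [h3]
        gcongr
        have h4 : (100 : ENNReal) * (Nat.card {i // (J i).IsApproxCover α (T.run (J i))} : ENNReal)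
            ≤ 98 * Fintype.card ι := by exact_mod_cast h2
        rw [← ENNReal.mul_div_right_comm, ENNReal.le_div_iff_mul_le (by simp) (by simp), mul_comm]
        simpa using h4
      · have h0 : A T = 0 := by simpa [PMF.mem_support_iff] using hTs
        simp [Set.indicator_apply, h0]
    calc ∑ i, A.successProb α (J i)
        = ∑ i, ∑' T, Set.indicator {T | (J i).IsApproxCover α (T.run (J i))} A T := by
          simp only [RandQueryAlg.successProb, PMF.toOuterMeasure_apply]
      _ = ∑' T, ∑ i, Set.indicator {T | (J i).IsApproxCover α (T.run (J i))} A T :=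
          (Summable.tsum_finsetSum fun _ _ => ENNReal.summable).symm
      _ ≤ ∑' T, A T * ((98 / 100 : ENNReal) * Fintype.card ι) := ENNReal.tsum_le_tsum h1
      _ = (98 / 100 : ENNReal) * Fintype.card ι := by
          rw [ENNReal.tsum_mul_right, A.tsum_coe, one_mul]
  have low : (99 / 100 : ENNReal) * Fintype.card ι ≤ ∑ i, A.successProb α (J i) := by
    calc (99 / 100 : ENNReal) * Fintype.card ι = ∑ _i : ι, (99 / 100 : ENNReal) := by
          simp [mul_comm]
      _ ≤ _ := Finset.sum_le_sum fun i _ => hA i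
  have h5 := low.trans key
  have hpos : (Fintype.card ι : ENNReal) ≠ 0 := by simp
  have h6 : (99 / 100 : ENNReal) ≤ 98 / 100 := by
    rwa [ENNReal.mul_le_mul_iff_left hpos (by simp)] at h5
  rw [ENNReal.div_le_iff (by simp) (by simp), ENNReal.div_mul_cancel (by simp) (by simp)] at h6
  norm_num at h6

/-! ### Inputs on which some query is needed -/

/-- The input in which the element `e` lies in the single set `r + f e`. -/
noncomputable def shiftedPartition {n m : ℕ} [NeZero m] (f : Fin n → Fin m) (r : Fin m) :
    SetCoverInstance n m where
  elts s := (Finset.univ.filter fun e => r + f e = s).toList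
  sets e := [r + f e]
  nodup_elts _ := Finset.nodup_toList _
  nodup_sets _ := List.nodup_singleton _
  mem_iff s e := by simp [eq_comm]

theorem shiftedPartition_isCover_iff {n m : ℕ} [NeZero m] (f : Fin n → Fin m) (r : Fin m)
    (D : Finset (Fin m)) : (shiftedPartition f r).IsCover D ↔ ∀ e, r + f e ∈ D := by
  simp [SetCoverInstance.IsCover, shiftedPartition]

theorem shiftedPartition_hasOpt {n m : ℕ} [NeZero m] (f : Fin n → Fin m) (r : Fin m) :
    (shiftedPartition f r).HasOpt (Finset.univ.image f).card := by
  constructor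
  · refine ⟨(Finset.univ.image f).image (r + ·), ?_, ?_⟩
    · rw [shiftedPartition_isCover_iff]
      intro e
      simp
    · exact Finset.card_image_of_injective _ (add_right_injective r)
  · rintro _ ⟨D, hD, rfl⟩
    rw [shiftedPartition_isCover_iff] at hD
    rw [← Finset.card_image_of_injective (Finset.univ.image f) (add_right_injective r)]
    refine Finset.card_le_card fun s hs => ?_
    simp only [Finset.mem_image, Finset.mem_univ, true_and] at hs
    obtain ⟨_, ⟨e, rfl⟩, rfl⟩ := hs
    exact hD e

/-- The map sending `j` to `min j (k - 1)`, whose image has `k` elements. -/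
theorem exists_card_image_eq {r w k : ℕ} (hk : 0 < k) (hr : k ≤ r) (hw : k ≤ w) :
    ∃ f : Fin r → Fin w, (Finset.univ.image f).card = k := by
  refine ⟨fun j => ⟨min j (k - 1), by omega⟩, ?_⟩
  have : (Finset.univ.image fun j : Fin r => (⟨min j (k - 1), by omega⟩ : Fin w))
      = Finset.univ.image (Fin.castLE hw) := by
    ext s
    simp only [Finset.mem_image, Finset.mem_univ, true_and]
    constructor
    · rintro ⟨j, rfl⟩
      exact ⟨⟨min j (k - 1), by omega⟩, rfl⟩
    · rintro ⟨j, rfl⟩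
      refine ⟨⟨j, by omega⟩, ?_⟩
      ext
      simp
      omega
  rw [this, Finset.card_image_of_injective _ (Fin.castLE_injective hw)]
  simp

/-- Among the shifts of a partition into `k` sets, a fixed small collection of sets covers at most
about half: a shift `r` for which `D` is a cover satisfies `r + f e ∈ D` for any one element `e`,
which leaves at most `#D` shifts, and avoids the `k` shifts moving a fixed set outside `D` onto a
part, which leaves at most `m - k`. -/
theorem card_isCover_shiftedPartition_le {n m : ℕ} [NeZero m] (f : Fin n → Fin m) (e : Fin n)
    (D : Finset (Fin m)) (hD : D.card < m) :
    Nat.card {r // (shiftedPartition f r).IsCover D} ≤ D.card ∧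
    Nat.card {r // (shiftedPartition f r).IsCover D} + (Finset.univ.image f).card ≤ m := by
  classical
  rw [Nat.card_eq_fintype_card, Fintype.card_subtype]
  simp only [shiftedPartition_isCover_iff]
  constructor
  · refine Finset.card_le_card_of_injOn (fun r => r + f e) ?_ ?_
    · intro r hr
      simp only [Finset.coe_filter, Finset.mem_univ, true_and, Set.mem_ofPred_eq] at hr
      exact hr e
    · exact fun x _ y _ h => add_left_injective _ h
  · obtain ⟨s, hs⟩ : ∃ s, s ∉ D := by
      by_contra! h
      have : D = Finset.univ := by ext; simp [h]
      simp [this] at hD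
    rw [← Finset.card_image_of_injective (Finset.univ.image f) (sub_right_injective (b := s)),
      ← Finset.card_union_of_disjoint]
    · simpa using Finset.card_le_univ (α := Fin m) _
    · rw [Finset.disjoint_left]
      intro r hr hr'
      simp only [Finset.mem_filter, Finset.mem_univ, true_and, Finset.mem_image] at hr hr'
      obtain ⟨_, ⟨e', rfl⟩, rfl⟩ := hr'
      exact hs (by simpa using hr e')

/-- An algorithm without queries fails on some shifted partition. -/
theorem exists_requiresQueries_one {n m k : ℕ} {α : ℝ} (hα : α ≤ 1.01) (hnm : n ≤ m) (hk : 2 ≤ k)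
    (hkn : 1.02 * (k : ℝ) ≤ n) (A : RandQueryAlg n m)
    (hA : ∀ I : SetCoverInstance n m, I.HasOpt k → 99 / 100 ≤ A.successProb α I) :
    ∃ I : SetCoverInstance n m, I.HasOpt k ∧ A.RequiresQueries I 1 := by
  have hkR : (2 : ℝ) ≤ k := by exact_mod_cast hk
  have hnmR : (n : ℝ) ≤ m := by exact_mod_cast hnm
  have hkn' : k ≤ n := by
    have : (k : ℝ) ≤ n := by linarith
    exact_mod_cast this
  have : NeZero m := ⟨by omega⟩
  obtain ⟨f, hf⟩ := exists_card_image_eq (by omega : 0 < k) hkn' (hkn'.trans hnm)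
  have hopt : ∀ r, (shiftedPartition f r).HasOpt k := fun r => hf ▸ shiftedPartition_hasOpt f r
  obtain ⟨r, hr⟩ := exists_requiresQueries A α 1 (shiftedPartition f)
    (fun r => hA _ (hopt r)) (by
      intro T hT
      cases T with
      | askElt s j next => exact absurd (hT 0) (by simp [QueryAlg.queries])
      | askSet e j next => exact absurd (hT 0) (by simp [QueryAlg.queries])
      | output D =>
        simp only [QueryAlg.run]
        by_cases hD : (D.card : ℝ) ≤ 1.01 * k
        · have hDm : D.card < m := by
            have : (D.card : ℝ) < m := by linarith
            exact_mod_cast this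
          obtain ⟨h1, h2⟩ := card_isCover_shiftedPartition_le f ⟨0, by omega⟩ D hDm
          have h3 : Nat.card {r // (shiftedPartition f r).IsApproxCover α D}
              ≤ Nat.card {r // (shiftedPartition f r).IsCover D} :=
            Nat.card_le_card_of_injective (fun x => ⟨x.1, x.2.1⟩)
              fun x y h => Subtype.ext (by simpa using h)
          rw [hf] at h2
          rw [Fintype.card_fin]
          have h1R : (Nat.card {r // (shiftedPartition f r).IsCover D} : ℝ) ≤ D.card := by
            exact_mod_cast h1
          have h2R : (Nat.card {r // (shiftedPartition f r).IsCover D} : ℝ) + k ≤ m := by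
            exact_mod_cast h2
          have h3R : (Nat.card {r // (shiftedPartition f r).IsApproxCover α D} : ℝ)
              ≤ Nat.card {r // (shiftedPartition f r).IsCover D} := by exact_mod_cast h3
          have : (100 * Nat.card {r // (shiftedPartition f r).IsApproxCover α D} : ℝ)
              ≤ 98 * m := by linarith
          exact_mod_cast this
        · have : IsEmpty {r // (shiftedPartition f r).IsApproxCover α D} := by
            refine ⟨fun x => hD ?_⟩
            obtain ⟨D', hD', hc⟩ := (hopt x.1).1
            have := x.2.2 D' hD'
            rw [hc] at this
            nlinarith
          simp)
  exact ⟨_, hopt r, hr⟩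

/-! ### Queries inside a block -/

namespace QueryAlg

variable {n m : ℕ} {B : Type*} [DecidableEq B]

/-- The number of queries on the input `I` whose argument belongs to the block `i`, where `oV` and
`oE` tell which block, if any, a set or an element belongs to. -/
def queriesIn (oV : Fin m → Option B) (oE : Fin n → Option B) (i : B)
    (I : SetCoverInstance n m) : QueryAlg n m → ℕ
  | output _ => 0
  | askElt s j next =>
      queriesIn oV oE i I (next (I.eltOf s j)) + if oV s = some i then 1 else 0
  | askSet e j next =>
      queriesIn oV oE i I (next (I.setOf e j)) + if oE e = some i then 1 else 0

theorem sum_ite_eq_some_le_one [Fintype B] (o : Option B) :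
    ∑ i, (if o = some i then 1 else 0) ≤ 1 := by
  cases o <;> simp

theorem sum_queriesIn_le [Fintype B] (oV : Fin m → Option B) (oE : Fin n → Option B)
    (I : SetCoverInstance n m) (T : QueryAlg n m) :
    ∑ i, T.queriesIn oV oE i I ≤ T.queries I := by
  induction T with
  | output D => simp [queriesIn, queries]
  | askElt s j next ih =>
    simp only [queriesIn, queries, Finset.sum_add_distrib]
    exact add_le_add (ih _) (sum_ite_eq_some_le_one _)
  | askSet e j next ih =>
    simp only [queriesIn, queries, Finset.sum_add_distrib]
    exact add_le_add (ih _) (sum_ite_eq_some_le_one _)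

/-- A search bound for one block. If answers outside the block `i` do not depend on `y`, and every
single answer differs from its default value `Y none` for at most a fraction `1 / R` of all `y`,
then `τ` queries inside the block lead to an output other than the default one for at most a
fraction `τ / R` of all `y`. -/
theorem card_run_ne_le {Θ : Type*} [Fintype Θ] (oV : Fin m → Option B) (oE : Fin n → Option B)
    (i : B) (Y : Option Θ → SetCoverInstance n m) (R : ℕ)
    (locV : ∀ s, oV s ≠ some i → ∀ y j, (Y y).eltOf s j = (Y none).eltOf s j)
    (locE : ∀ e, oE e ≠ some i → ∀ y j, (Y y).setOf e j = (Y none).setOf e j)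
    (hidV : ∀ s j, R * Nat.card {y // (Y (some y)).eltOf s j ≠ (Y none).eltOf s j}
      ≤ Fintype.card Θ)
    (hidE : ∀ e j, R * Nat.card {y // (Y (some y)).setOf e j ≠ (Y none).setOf e j}
      ≤ Fintype.card Θ)
    (T : QueryAlg n m) (τ : ℕ) :
    R * Nat.card {y // T.queriesIn oV oE i (Y (some y)) ≤ τ ∧
      T.run (Y (some y)) ≠ T.run (Y none)} ≤ τ * Fintype.card Θ := by
  classical
  simp only [Nat.card_eq_fintype_card, Fintype.card_subtype] at *
  induction T generalizing τ with
  | output D => simp [run]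
  | askElt s j next ih =>
    simp only [queriesIn, run]
    by_cases hs : oV s = some i
    · simp only [hs, if_true]
      cases τ with
      | zero => simp
      | succ τ =>
        have h : (Finset.univ.filter fun y =>
              queriesIn oV oE i (Y (some y)) (next ((Y (some y)).eltOf s j)) + 1 ≤ τ + 1 ∧
              run (Y (some y)) (next ((Y (some y)).eltOf s j)) ≠
                run (Y none) (next ((Y none).eltOf s j)))
            ⊆ (Finset.univ.filter fun y => (Y (some y)).eltOf s j ≠ (Y none).eltOf s j) ∪
              Finset.univ.filter fun y =>
                queriesIn oV oE i (Y (some y)) (next ((Y none).eltOf s j)) ≤ τ ∧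
                run (Y (some y)) (next ((Y none).eltOf s j)) ≠
                  run (Y none) (next ((Y none).eltOf s j)) := by
          intro y hy
          by_cases hya : (Y (some y)).eltOf s j = (Y none).eltOf s j
          · simp only [Finset.mem_filter, Finset.mem_univ, true_and, hya] at hy
            simp only [Finset.mem_union, Finset.mem_filter, Finset.mem_univ, true_and]
            exact Or.inr ⟨by omega, hy.2⟩
          · simp [hya]
        have h1 := (Finset.card_le_card h).trans (Finset.card_union_le _ _)
        have h2 := hidV s j
        have h3 := ih ((Y none).eltOf s j) τ
        nlinarith
    · have hl := locV s hs
      simpa only [hs, hl, if_false, add_zero] using ih ((Y none).eltOf s j) τ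
  | askSet e j next ih =>
    simp only [queriesIn, run]
    by_cases he : oE e = some i
    · simp only [he, if_true]
      cases τ with
      | zero => simp
      | succ τ =>
        have h : (Finset.univ.filter fun y =>
              queriesIn oV oE i (Y (some y)) (next ((Y (some y)).setOf e j)) + 1 ≤ τ + 1 ∧
              run (Y (some y)) (next ((Y (some y)).setOf e j)) ≠
                run (Y none) (next ((Y none).setOf e j)))
            ⊆ (Finset.univ.filter fun y => (Y (some y)).setOf e j ≠ (Y none).setOf e j) ∪
              Finset.univ.filter fun y =>
                queriesIn oV oE i (Y (some y)) (next ((Y none).setOf e j)) ≤ τ ∧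
                run (Y (some y)) (next ((Y none).setOf e j)) ≠
                  run (Y none) (next ((Y none).setOf e j)) := by
          intro y hy
          by_cases hya : (Y (some y)).setOf e j = (Y none).setOf e j
          · simp only [Finset.mem_filter, Finset.mem_univ, true_and, hya] at hy
            simp only [Finset.mem_union, Finset.mem_filter, Finset.mem_univ, true_and]
            exact Or.inr ⟨by omega, hy.2⟩
          · simp [hya]
        have h1 := (Finset.card_le_card h).trans (Finset.card_union_le _ _)
        have h2 := hidE e j
        have h3 := ih ((Y none).setOf e j) τ
        nlinarith
    · have hl := locE e he
      simpa only [he, hl, if_false, add_zero] using ih ((Y none).setOf e j) τ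

end QueryAlg

/-! ### Gadgets and their disjoint unions -/

/-- A family of small Set Cover inputs with sets `V`, core elements `K` and padding elements `P`,
indexed by a secret in `Θ`, together with a default member `none`. For every secret exactly one set,
the special one, contains the whole core. -/
structure Gadget (V K P Θ : Type) where
  elts : Option Θ → V → List (K ⊕ P)
  sets : Option Θ → K ⊕ P → List V
  nodup_elts : ∀ o v, (elts o v).Nodup
  nodup_sets : ∀ o x, (sets o x).Nodup
  mem_iff : ∀ o v x, x ∈ elts o v ↔ v ∈ sets o x
  special : Θ → V
  core_subset : ∀ y c, special y ∈ sets (some y) (Sum.inl c)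
  eq_special : ∀ y v, (∀ c, v ∈ sets (some y) (Sum.inl c)) → v = special y

namespace Gadget

variable {V K P Θ : Type}

/-- No answer reveals much about the secret: every entry of a list differs from its default value
for at most a fraction `1 / R` of the secrets, and every set is special for at most one percent
of them. -/
structure IsHiding [Fintype Θ] (G : Gadget V K P Θ) (R : ℕ) : Prop where
  elts_le : ∀ v (j : ℕ), R * Nat.card {y // (G.elts (some y) v)[j]? ≠ (G.elts none v)[j]?}
    ≤ Fintype.card Θ
  sets_le : ∀ x (j : ℕ), R * Nat.card {y // (G.sets (some y) x)[j]? ≠ (G.sets none x)[j]?}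
    ≤ Fintype.card Θ
  special_le : ∀ v, 100 * Nat.card {y // G.special y = v} ≤ Fintype.card Θ

variable {B E W : Type} {n m : ℕ}

/-- The static set, if any, containing an element of a union of gadgets: core elements lie in no
static set, all padding lies in the static set `w₀`, and any further element `x : E` in `f x`. -/
def static (f : E → W) (w₀ : W) : (B × (K ⊕ P)) ⊕ E → Option W
  | Sum.inl (_, Sum.inl _) => none
  | Sum.inl (_, Sum.inr _) => some w₀
  | Sum.inr x => some (f x)

/-- The elements of a set in a union of gadgets. -/
noncomputable def unionElts [Fintype B] [Fintype E] [Fintype K] [Fintype P]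
    (G : Gadget V K P Θ) (f : E → W) (w₀ : W) (θ : B → Option Θ) :
    (B × V) ⊕ W → List ((B × (K ⊕ P)) ⊕ E)
  | Sum.inl (i, v) => (G.elts (θ i) v).map fun x => Sum.inl (i, x)
  | Sum.inr w => by
      classical exact (Finset.univ.filter fun x => static f w₀ x = some w).toList

/-- The sets containing an element of a union of gadgets, the static one first. -/
def unionSets (G : Gadget V K P Θ) (f : E → W) (w₀ : W) (θ : B → Option Θ)
    (x : (B × (K ⊕ P)) ⊕ E) : List ((B × V) ⊕ W) :=
  (static f w₀ x).toList.map Sum.inr ++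
    match x with
    | Sum.inl (i, x) => (G.sets (θ i) x).map fun v => Sum.inl (i, v)
    | Sum.inr _ => []

/-- The sets of block `i` that belong to `D`. -/
noncomputable def blockPart [Fintype V] (eV : (B × V) ⊕ W ≃ Fin m) (D : Finset (Fin m)) (i : B) :
    Finset V := Finset.univ.filter fun v => eV (Sum.inl (i, v)) ∈ D

theorem card_eq_sum_blockPart [Fintype B] [Fintype V] [Fintype W]
    (eV : (B × V) ⊕ W ≃ Fin m) (D : Finset (Fin m)) :
    D.card = ∑ i, (blockPart eV D i).card +
      (Finset.univ.filter fun w => eV (Sum.inr w) ∈ D).card := by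
  have : D.card = ∑ s, if s ∈ D then 1 else 0 := by simp
  rw [this, ← Equiv.sum_comp eV, Fintype.sum_sum_type, Fintype.sum_prod_type]
  simp [blockPart]

variable [Fintype B] [Fintype E] [Fintype K] [Fintype P]

/-- The disjoint union of copies of a gadget, one for each `i : B` and with the secret `θ i`, and
of a partition of all padding and of the elements `E` into the static sets `W`. -/
noncomputable def union (G : Gadget V K P Θ) (f : E → W) (w₀ : W)
    (eE : (B × (K ⊕ P)) ⊕ E ≃ Fin n) (eV : (B × V) ⊕ W ≃ Fin m) (θ : B → Option Θ) :
    SetCoverInstance n m where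
  elts s := (G.unionElts f w₀ θ (eV.symm s)).map eE
  sets e := (G.unionSets f w₀ θ (eE.symm e)).map eV
  nodup_elts s := by
    refine List.Nodup.map eE.injective ?_
    rcases eV.symm s with ⟨i, v⟩ | w
    · exact (G.nodup_elts _ _).map fun x y h => by simpa using h
    · exact Finset.nodup_toList _
  nodup_sets e := by
    refine List.Nodup.map eV.injective ?_
    rcases eE.symm e with ⟨i, c | p⟩ | x
    · simpa [unionSets, static] using
        (G.nodup_sets (θ i) (Sum.inl c)).map (f := fun v => (Sum.inl (i, v) : (B × V) ⊕ W))
          fun x y h => by simpa using h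
    · simpa [unionSets, static] using
        (G.nodup_sets (θ i) (Sum.inr p)).map (f := fun v => (Sum.inl (i, v) : (B × V) ⊕ W))
          fun x y h => by simpa using h
    · simp [unionSets, static]
  mem_iff s e := by
    obtain ⟨s, rfl⟩ := eV.surjective s
    obtain ⟨e, rfl⟩ := eE.surjective e
    rw [Equiv.symm_apply_apply, Equiv.symm_apply_apply, List.mem_map_of_injective eE.injective,
      List.mem_map_of_injective eV.injective]
    rcases s with ⟨i, v⟩ | w <;> rcases e with ⟨i', c | p⟩ | x
    · simp only [unionElts, unionSets, static, List.mem_map, Option.toList_none, List.map_nil,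
        List.nil_append, Sum.inl.injEq, Prod.mk.injEq]
      constructor
      · rintro ⟨x, hx, rfl, rfl⟩
        exact ⟨v, (G.mem_iff _ _ _).1 hx, rfl, rfl⟩
      · rintro ⟨x, hx, rfl, rfl⟩
        exact ⟨_, (G.mem_iff _ _ _).2 hx, rfl, rfl⟩
    · simp only [unionElts, unionSets, static, List.mem_map, Option.toList_some, List.map_cons,
        List.map_nil, List.cons_append, List.nil_append, List.mem_cons, reduceCtorEq, false_or,
        Sum.inl.injEq, Prod.mk.injEq]
      constructor
      · rintro ⟨x, hx, rfl, rfl⟩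
        exact ⟨v, (G.mem_iff _ _ _).1 hx, rfl, rfl⟩
      · rintro ⟨x, hx, rfl, rfl⟩
        exact ⟨_, (G.mem_iff _ _ _).2 hx, rfl, rfl⟩
    · simp [unionElts, unionSets, static]
    all_goals
      simp only [unionElts, Finset.mem_toList, Finset.mem_filter, Finset.mem_univ, true_and]
      simp [unionSets, static, eq_comm]

section cover

variable (G : Gadget V K P Θ) (f : E → W) (w₀ : W)
  (eE : (B × (K ⊕ P)) ⊕ E ≃ Fin n) (eV : (B × V) ⊕ W ≃ Fin m)

theorem exists_mem_blockPart_of_isCover [Fintype V] {θ : B → Option Θ} {D : Finset (Fin m)}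
    (hD : (G.union f w₀ eE eV θ).IsCover D) (i : B) (c : K) :
    ∃ v ∈ blockPart eV D i, v ∈ G.sets (θ i) (Sum.inl c) := by
  obtain ⟨s, hs, hes⟩ := hD (eE (Sum.inl (i, Sum.inl c)))
  rw [SetCoverInstance.mem_iff] at hes
  simp only [union, Equiv.symm_apply_apply, unionSets, static, Option.toList_none, List.map_nil,
    List.nil_append, List.map_map, List.mem_map, Function.comp_apply] at hes
  obtain ⟨v, hv, rfl⟩ := hes
  exact ⟨v, by simpa [blockPart] using hs, hv⟩

theorem inr_mem_of_isCover {θ : B → Option Θ} {D : Finset (Fin m)}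
    (hD : (G.union f w₀ eE eV θ).IsCover D) (x : E) : eV (Sum.inr (f x)) ∈ D := by
  obtain ⟨s, hs, hes⟩ := hD (eE (Sum.inr x))
  rw [SetCoverInstance.mem_iff] at hes
  simp only [union, Equiv.symm_apply_apply, unionSets, static, Option.toList_some, List.map_cons,
    List.map_nil, List.append_nil, List.mem_singleton] at hes
  rwa [← hes]

/-- A cover spends one set on each static part and on each block, and a second one on each block
whose special set it does not identify. -/
theorem le_card_of_isCover [Fintype V] [Fintype W] [DecidableEq W] [Nonempty K]
    [DecidableEq V] {θ : B → Θ} {D : Finset (Fin m)}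
    (hD : (G.union f w₀ eE eV (fun i => some (θ i))).IsCover D) :
    Fintype.card B + (Finset.univ.image f).card +
      (Finset.univ.filter fun i => blockPart eV D i ≠ {G.special (θ i)}).card ≤ D.card := by
  rw [card_eq_sum_blockPart eV D]
  have h1 : (Finset.univ.image f).card ≤
      (Finset.univ.filter fun w => eV (Sum.inr w) ∈ D).card := by
    refine Finset.card_le_card fun w hw => ?_
    simp only [Finset.mem_image, Finset.mem_univ, true_and] at hw
    obtain ⟨x, rfl⟩ := hw
    simpa using G.inr_mem_of_isCover f w₀ eE eV hD x
  have h2 : ∀ i, 1 + (if blockPart eV D i ≠ {G.special (θ i)} then 1 else 0)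
      ≤ (blockPart eV D i).card := by
    intro i
    obtain ⟨c⟩ := ‹Nonempty K›
    obtain ⟨v, hv, -⟩ := G.exists_mem_blockPart_of_isCover f w₀ eE eV hD i c
    have hpos : 0 < (blockPart eV D i).card := Finset.card_pos.2 ⟨v, hv⟩
    split_ifs with h
    · by_contra hlt
      obtain ⟨u, hu⟩ := Finset.card_eq_one.1 (by omega : (blockPart eV D i).card = 1)
      refine h (hu.trans ?_)
      rw [G.eq_special (θ i) u]
      intro c
      obtain ⟨v, hv, hvc⟩ := G.exists_mem_blockPart_of_isCover f w₀ eE eV hD i c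
      rw [hu, Finset.mem_singleton] at hv
      exact hv ▸ hvc
    · omega
  have h3 := Finset.sum_le_sum fun i (_ : i ∈ Finset.univ) => h2 i
  rw [Finset.sum_add_distrib, ← Finset.card_filter] at h3
  simp only [Finset.sum_const, Finset.card_univ, smul_eq_mul, mul_one] at h3
  omega

theorem union_hasOpt [Fintype V] [Fintype W] [DecidableEq W] [Nonempty K]
    (hw₀ : w₀ ∈ Finset.univ.image f) (θ : B → Θ) :
    (G.union f w₀ eE eV (fun i => some (θ i))).HasOpt
      (Fintype.card B + (Finset.univ.image f).card) := by
  classical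
  constructor
  · let e : B ⊕ W → Fin m := fun x => eV (x.map (fun i => (i, G.special (θ i))) id)
    have he : Function.Injective e := by
      refine eV.injective.comp ?_
      exact Sum.map_injective.2 ⟨fun i j h => (Prod.mk.inj h).1, Function.injective_id⟩
    refine ⟨(Finset.univ.disjSum (Finset.univ.image f)).image e, ?_, ?_⟩
    · intro x
      obtain ⟨x, rfl⟩ := eE.surjective x
      rcases x with ⟨i, c | p⟩ | x
      · refine ⟨e (Sum.inl i), Finset.mem_image_of_mem _ (by simp), (SetCoverInstance.mem_iff _ _ _).2 ?_⟩
        simpa [union, unionSets, static, e] using G.core_subset (θ i) c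
      · refine ⟨e (Sum.inr w₀), Finset.mem_image_of_mem _ ?_, (SetCoverInstance.mem_iff _ _ _).2 ?_⟩
        · exact Finset.inr_mem_disjSum.2 hw₀
        · simp [union, unionSets, static, e]
      · refine ⟨e (Sum.inr (f x)), Finset.mem_image_of_mem _ (by simp), (SetCoverInstance.mem_iff _ _ _).2 ?_⟩
        simp [union, unionSets, static, e]
    · rw [Finset.card_image_of_injective _ he, Finset.card_disjSum, Finset.card_univ]
  · rintro _ ⟨D, hD, rfl⟩
    exact (Nat.le_add_right _ _).trans (G.le_card_of_isCover f w₀ eE eV hD)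

end cover
end Gadget

/-! ### The direct sum argument -/

theorem natCard_subtype_mono {Y : Type*} [Finite Y] {p q : Y → Prop} (h : ∀ y, p y → q y) :
    Nat.card {y // p y} ≤ Nat.card {y // q y} :=
  Nat.card_le_card_of_injective (Subtype.map id h) (Subtype.map_injective h Function.injective_id)

/-- A bound on the proportion of vectors with a property that holds after resampling the coordinate
`i`, whatever the other coordinates are, holds on the whole. -/
theorem card_le_of_card_update_le {B Θ : Type*} [Fintype B] [DecidableEq B] [Fintype Θ] (i : B)
    (p : (B → Θ) → Prop) (a c : ℕ)
    (h : ∀ θ, a * Nat.card {y // p (Function.update θ i y)} ≤ c * Fintype.card Θ) :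
    a * Nat.card {θ // p θ} ≤ c * Fintype.card (B → Θ) := by
  classical
  rcases isEmpty_or_nonempty Θ with hΘ | hΘ
  · have : IsEmpty (B → Θ) := ⟨fun θ => hΘ.false (θ i)⟩
    simp
  have hpos : 0 < Fintype.card Θ := Fintype.card_pos
  have inv : ∀ x : (B → Θ) × Θ,
      (Function.update (Function.update x.1 i x.2) i (x.1 i),
        (Function.update x.1 i x.2) i) = x := by
    rintro ⟨θ, y⟩
    simp
  -- Exchanging the `i`-th coordinate with an independent copy of it is an involution.
  let e : (B → Θ) × Θ ≃ (B → Θ) × Θ :=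
    ⟨fun x => (Function.update x.1 i x.2, x.1 i), fun x => (Function.update x.1 i x.2, x.1 i),
      inv, inv⟩
  have key : ∑ θ : B → Θ, Nat.card {y // p (Function.update θ i y)}
      = Nat.card {θ // p θ} * Fintype.card Θ := by
    have h1 := Equiv.sum_comp e fun x : (B → Θ) × Θ => if p x.1 then 1 else 0
    rw [Fintype.sum_prod_type, Fintype.sum_prod_type] at h1
    simp only [e, Equiv.coe_fn_mk] at h1
    simp only [Nat.card_eq_fintype_card, Fintype.card_subtype, Finset.card_filter]
    rw [h1, Finset.sum_mul]
    refine Finset.sum_congr rfl fun θ _ => ?_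
    split_ifs <;> simp
  have h2 := Finset.sum_le_sum fun θ (_ : θ ∈ Finset.univ) => h θ
  rw [← Finset.mul_sum, key, Finset.sum_const, Finset.card_univ, smul_eq_mul] at h2
  refine Nat.le_of_mul_le_mul_right ?_ hpos
  calc a * Nat.card {θ // p θ} * Fintype.card Θ
      = a * (Nat.card {θ // p θ} * Fintype.card Θ) := by ring
    _ ≤ _ := h2
    _ = _ := by ring

namespace Gadget

variable {V K P Θ B E W : Type} {n m : ℕ}

/-- The block, if any, to which a set or an element of a union of gadgets belongs. -/
def block {X Z : Type} (e : (B × X) ⊕ Z ≃ Fin n) (s : Fin n) : Option B :=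
  (e.symm s).elim (fun x => some x.1) fun _ => none

variable [Fintype B] [Fintype E] [Fintype K] [Fintype P]
  (G : Gadget V K P Θ) (f : E → W) (w₀ : W)
  (eE : (B × (K ⊕ P)) ⊕ E ≃ Fin n) (eV : (B × V) ⊕ W ≃ Fin m)

theorem union_eltOf_congr {θ θ' : B → Option Θ} (s : Fin m) (j : ℕ)
    (h : ∀ i, block eV s = some i → θ i = θ' i) :
    (G.union f w₀ eE eV θ).eltOf s j = (G.union f w₀ eE eV θ').eltOf s j := by
  simp only [block] at h
  simp only [SetCoverInstance.eltOf, union]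
  generalize eV.symm s = s at h ⊢
  rcases s with ⟨i, v⟩ | w
  · simp [unionElts, h i rfl]
  · simp [unionElts]

theorem union_setOf_congr {θ θ' : B → Option Θ} (e : Fin n) (j : ℕ)
    (h : ∀ i, block eE e = some i → θ i = θ' i) :
    (G.union f w₀ eE eV θ).setOf e j = (G.union f w₀ eE eV θ').setOf e j := by
  simp only [block] at h
  simp only [SetCoverInstance.setOf, union]
  generalize eE.symm e = e at h ⊢
  rcases e with ⟨i, x⟩ | x
  · simp [unionSets, h i rfl]
  · simp [unionSets]

variable {G} [Fintype Θ] [DecidableEq B] {R : ℕ}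

theorem IsHiding.card_eltOf_ne_le (hG : G.IsHiding R) (θ : B → Option Θ) (i : B) (s : Fin m)
    (j : ℕ) :
    R * Nat.card {y // (G.union f w₀ eE eV (Function.update θ i (some y))).eltOf s j ≠
      (G.union f w₀ eE eV (Function.update θ i none)).eltOf s j} ≤ Fintype.card Θ := by
  by_cases hs : block eV s = some i
  · obtain ⟨⟨i', v⟩ | w, rfl⟩ := eV.surjective s
    · obtain rfl : i' = i := by simpa [block] using hs
      refine (Nat.mul_le_mul_left _ (natCard_subtype_mono fun y => ?_)).trans (hG.elts_le v j)
      contrapose!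
      intro h
      simp [SetCoverInstance.eltOf, union, unionElts, h]
    · simp [block] at hs
  · have : IsEmpty {y // (G.union f w₀ eE eV (Function.update θ i (some y))).eltOf s j ≠
        (G.union f w₀ eE eV (Function.update θ i none)).eltOf s j} := by
      refine ⟨fun y => y.2 (G.union_eltOf_congr f w₀ eE eV s j fun i' hi' => ?_)⟩
      have : i' ≠ i := fun h => hs (h ▸ hi')
      simp [this]
    simp

theorem IsHiding.card_setOf_ne_le (hG : G.IsHiding R) (θ : B → Option Θ) (i : B) (e : Fin n)
    (j : ℕ) :
    R * Nat.card {y // (G.union f w₀ eE eV (Function.update θ i (some y))).setOf e j ≠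
      (G.union f w₀ eE eV (Function.update θ i none)).setOf e j} ≤ Fintype.card Θ := by
  by_cases hs : block eE e = some i
  · obtain ⟨⟨i', x⟩ | w, rfl⟩ := eE.surjective e
    · obtain rfl : i' = i := by simpa [block] using hs
      refine (Nat.mul_le_mul_left _ (natCard_subtype_mono fun y => ?_)).trans
        (hG.sets_le x (j - (static f w₀ (Sum.inl (i', x) : (B × (K ⊕ P)) ⊕ E)).toList.length))
      contrapose!
      intro h
      simp only [SetCoverInstance.setOf, union, unionSets, Equiv.symm_apply_apply,
        Function.update_self, List.map_append, List.getElem?_append, List.length_map,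
        List.getElem?_map, h]
    · simp [block] at hs
  · have : IsEmpty {y // (G.union f w₀ eE eV (Function.update θ i (some y))).setOf e j ≠
        (G.union f w₀ eE eV (Function.update θ i none)).setOf e j} := by
      refine ⟨fun y => y.2 (G.union_setOf_congr f w₀ eE eV e j fun i' hi' => ?_)⟩
      have : i' ≠ i := fun h => hs (h ▸ hi')
      simp [this]
    simp

variable [Fintype V] [DecidableEq V]

/-- With few queries an algorithm identifies the special set of a block for a small proportion of
the pairs of a block and a vector of secrets: the block receives more than `τ` queries, or a query
in it hits an entry depending on the secret, or the output is the one obtained when the block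
carries the default member of the family, and then it identifies the special set by luck. -/
theorem IsHiding.sum_card_identified_le (hG : G.IsHiding R) (hR : 0 < R) (T : QueryAlg n m)
    (q : ℝ) (τ : ℕ)
    (hT : ∀ θ : B → Θ, (T.queries (G.union f w₀ eE eV fun i => some (θ i)) : ℝ) ≤ q) :
    ∑ i : B, (Nat.card {θ : B → Θ // blockPart eV
        (T.run (G.union f w₀ eE eV fun i => some (θ i))) i = {G.special (θ i)}} : ℝ) ≤
      (q / (τ + 1) + Fintype.card B * (τ / R) + Fintype.card B / 100) *
        Fintype.card (B → Θ) := by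
  classical
  set I : (B → Θ) → SetCoverInstance n m := fun θ => G.union f w₀ eE eV fun i => some (θ i)
    with hI
  set Y : (B → Θ) → B → Option Θ → SetCoverInstance n m := fun θ i o =>
    G.union f w₀ eE eV (Function.update (fun i => some (θ i)) i o) with hY
  have hYI : ∀ θ i y, Y θ i (some y) = I (Function.update θ i y) := by
    intro θ i y
    simp only [hY, hI]
    congr 1
    ext1 j
    by_cases hj : j = i
    · subst hj; simp
    · simp [hj]
  have hYn : ∀ θ i y, Y (Function.update θ i y) i none = Y θ i none := by
    intro θ i y
    simp only [hY]
    congr 1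
    ext1 j
    by_cases hj : j = i
    · subst hj; simp
    · simp [hj]
  set cnt : B → (B → Θ) → ℕ := fun i θ => T.queriesIn (block eV) (block eE) i (I θ) with hcnt
  have h1 : ∑ i, (Nat.card {θ // τ < cnt i θ} : ℝ) ≤ q / (τ + 1) * Fintype.card (B → Θ) := by
    have hle : ∀ i, (Nat.card {θ // τ < cnt i θ} : ℝ) * (τ + 1) ≤ ∑ θ, (cnt i θ : ℝ) := by
      intro i
      rw [Nat.card_eq_fintype_card, Fintype.card_subtype, Finset.card_filter]
      push_cast
      rw [Finset.sum_mul]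
      refine Finset.sum_le_sum fun θ _ => ?_
      split_ifs with hθ
      · rw [one_mul]
        exact_mod_cast hθ
      · simp
    have hsum : ∀ θ, ∑ i, (cnt i θ : ℝ) ≤ q := by
      intro θ
      refine le_trans ?_ (hT θ)
      exact_mod_cast T.sum_queriesIn_le (block eV) (block eE) (I θ)
    rw [div_mul_eq_mul_div, le_div_iff₀ (by positivity), Finset.sum_mul]
    calc ∑ i, (Nat.card {θ // τ < cnt i θ} : ℝ) * (τ + 1)
        ≤ ∑ i, ∑ θ, (cnt i θ : ℝ) := Finset.sum_le_sum fun i _ => hle i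
      _ = ∑ θ, ∑ i, (cnt i θ : ℝ) := Finset.sum_comm
      _ ≤ ∑ _θ : B → Θ, q := Finset.sum_le_sum fun θ _ => hsum θ
      _ = q * Fintype.card (B → Θ) := by
          rw [Finset.sum_const, Finset.card_univ, nsmul_eq_mul, mul_comm]
  have h2 : ∀ i, (Nat.card {θ // cnt i θ ≤ τ ∧ T.run (I θ) ≠ T.run (Y θ i none)} : ℝ)
      ≤ τ / R * Fintype.card (B → Θ) := by
    intro i
    have := card_le_of_card_update_le i
      (fun θ => cnt i θ ≤ τ ∧ T.run (I θ) ≠ T.run (Y θ i none)) R τ (by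
        intro θ
        have := T.card_run_ne_le (block eV) (block eE) i (Y θ i) R
          (fun s hs y j => G.union_eltOf_congr f w₀ eE eV s j fun i' hi' => by
            have : i' ≠ i := fun h => hs (h ▸ hi')
            simp [this])
          (fun e he y j => G.union_setOf_congr f w₀ eE eV e j fun i' hi' => by
            have : i' ≠ i := fun h => he (h ▸ hi')
            simp [this])
          (hG.card_eltOf_ne_le f w₀ eE eV _ i) (hG.card_setOf_ne_le f w₀ eE eV _ i) τ
        simpa only [hYI, hYn] using this)
    rw [div_mul_eq_mul_div, le_div_iff₀ (by positivity), mul_comm]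
    exact_mod_cast this
  have h3 : ∀ i, (Nat.card {θ : B → Θ // blockPart eV (T.run (Y θ i none)) i =
      {G.special (θ i)}} : ℝ) ≤ 1 / 100 * Fintype.card (B → Θ) := by
    intro i
    have := card_le_of_card_update_le i
      (fun θ => blockPart eV (T.run (Y θ i none)) i = {G.special (θ i)}) 100 1 (by
        intro θ
        simp only [hYn, Function.update_self, one_mul]
        by_cases hv : ∃ v, blockPart eV (T.run (Y θ i none)) i = {v}
        · obtain ⟨v, hv⟩ := hv
          refine (Nat.mul_le_mul_left _ (natCard_subtype_mono fun y hy => ?_)).trans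
            (hG.special_le v)
          rw [hv, Finset.singleton_inj] at hy
          exact hy.symm
        · have : IsEmpty {y // blockPart eV (T.run (Y θ i none)) i = {G.special y}} :=
            ⟨fun y => hv ⟨_, y.2⟩⟩
          simp)
    have h : (100 : ℝ) * (Nat.card {θ : B → Θ // blockPart eV (T.run (Y θ i none)) i =
      {G.special (θ i)}} : ℝ) ≤ 1 * Fintype.card (B → Θ) := by exact_mod_cast this
    linarith
  have hsplit : ∀ i, (Nat.card {θ : B → Θ // blockPart eV (T.run (I θ)) i =
      {G.special (θ i)}} : ℝ) ≤ Nat.card {θ // τ < cnt i θ} +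
        Nat.card {θ // cnt i θ ≤ τ ∧ T.run (I θ) ≠ T.run (Y θ i none)} +
        Nat.card {θ : B → Θ // blockPart eV (T.run (Y θ i none)) i = {G.special (θ i)}} := by
    intro i
    simp only [Nat.card_eq_fintype_card, Fintype.card_subtype]
    norm_cast
    refine le_trans (Finset.card_le_card ?_) ((Finset.card_union_le _ _).trans
      (Nat.add_le_add_right (Finset.card_union_le _ _) _))
    intro θ hθ
    simp only [Finset.mem_union, Finset.mem_filter, Finset.mem_univ, true_and] at hθ ⊢
    by_cases hc : τ < cnt i θ
    · exact Or.inl (Or.inl hc)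
    · by_cases hr : T.run (I θ) = T.run (Y θ i none)
      · exact Or.inr (hr ▸ hθ)
      · exact Or.inl (Or.inr ⟨not_lt.1 hc, hr⟩)
  calc _ ≤ ∑ i, ((Nat.card {θ // τ < cnt i θ} : ℝ) + τ / R * Fintype.card (B → Θ) +
        1 / 100 * Fintype.card (B → Θ)) := Finset.sum_le_sum fun i _ => by
          linarith [hsplit i, h2 i, h3 i]
    _ = ∑ i, (Nat.card {θ // τ < cnt i θ} : ℝ) +
        Fintype.card B * (τ / R * Fintype.card (B → Θ)) +
        Fintype.card B * (1 / 100 * Fintype.card (B → Θ)) := by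
          simp only [Finset.sum_add_distrib, Finset.sum_const, Finset.card_univ, nsmul_eq_mul]
    _ ≤ q / (τ + 1) * Fintype.card (B → Θ) +
        Fintype.card B * (τ / R * Fintype.card (B → Θ)) +
        Fintype.card B * (1 / 100 * Fintype.card (B → Θ)) := by gcongr
    _ = _ := by ring

/-- The query lower bound for a union of hiding gadgets. An approximate cover must identify the
special set in at least half of the blocks, as each other block costs one more set and the blocks
make up at least one fiftieth of the optimum. -/
theorem IsHiding.exists_requiresQueries [Fintype W] [DecidableEq W] [Nonempty K] [Nonempty B]
    [Nonempty Θ] (eE : (B × (K ⊕ P)) ⊕ E ≃ Fin n) (eV : (B × V) ⊕ W ≃ Fin m) (hG : G.IsHiding R) (hR : 0 < R) (hw₀ : w₀ ∈ Finset.univ.image f) {k : ℕ}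
    (hk : Fintype.card B + (Finset.univ.image f).card = k) (hkB : k ≤ 50 * Fintype.card B)
    {α : ℝ} (hα : α ≤ 1.01) (A : RandQueryAlg n m)
    (hA : ∀ I : SetCoverInstance n m, I.HasOpt k → 99 / 100 ≤ A.successProb α I) :
    ∃ I : SetCoverInstance n m, I.HasOpt k ∧
      A.RequiresQueries I (Fintype.card B * R / 100) := by
  classical
  have hopt : ∀ θ : B → Θ, (G.union f w₀ eE eV fun i => some (θ i)).HasOpt k := fun θ =>
    hk ▸ G.union_hasOpt f w₀ eE eV hw₀ θ
  obtain ⟨θ, hθ⟩ := _root_.exists_requiresQueries A α ((Fintype.card B : ℝ) * R / 100)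
    (fun θ : B → Θ => G.union f w₀ eE eV fun i => some (θ i)) (fun θ => hA _ (hopt θ)) (by
      intro T hT
      have hRR : (0 : ℝ) < R := by exact_mod_cast hR
      have hb : (0 : ℝ) < Fintype.card B := by exact_mod_cast Fintype.card_pos
      set b : ℝ := (Fintype.card B : ℝ) with hbdef
      set N : ℝ := (Fintype.card (B → Θ) : ℝ) with hN
      have hNpos : 0 ≤ N := by positivity
      -- The threshold `τ` balances the first two terms of the bound.
      set τ : ℕ := ⌊(R : ℝ) / 10⌋₊ with hτ
      have hτ1 : (τ : ℝ) ≤ R / 10 := Nat.floor_le (by positivity)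
      have hτ2 : (R : ℝ) / 10 < τ + 1 := Nat.lt_floor_add_one _
      have hsum := hG.sum_card_identified_le f w₀ eE eV hR T _ τ fun θ => (hT θ).le
      have e1 : b * R / 100 / (τ + 1) ≤ b / 10 := by
        rw [div_le_iff₀ (by positivity)]
        nlinarith
      have e2 : b * (τ / R) ≤ b / 10 := by
        have : (τ : ℝ) / R ≤ 1 / 10 := by
          rw [div_le_iff₀ hRR]
          linarith
        nlinarith
      have hsucc : ∀ θ : B → Θ, (G.union f w₀ eE eV fun i => some (θ i)).IsApproxCover α
          (T.run (G.union f w₀ eE eV fun i => some (θ i))) →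
          b ≤ 2 * (Finset.univ.filter fun i => blockPart eV
            (T.run (G.union f w₀ eE eV fun i => some (θ i))) i = {G.special (θ i)}).card := by
        intro θ ⟨hc, hD⟩
        obtain ⟨D', hD', hc'⟩ := (hopt θ).1
        have hα' := hD D' hD'
        have hle := G.le_card_of_isCover f w₀ eE eV hc
        have hcompl := Finset.card_filter_add_card_filter_not (s := Finset.univ) fun i =>
          blockPart eV (T.run (G.union f w₀ eE eV fun i => some (θ i))) i = {G.special (θ i)}
        rw [hk] at hle
        rw [Finset.card_univ] at hcompl
        have hleR := (Nat.cast_le (α := ℝ)).2 hle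
        have hcomplR := congrArg (Nat.cast (R := ℝ)) hcompl
        push_cast at hleR hcomplR
        have hkBR : (k : ℝ) ≤ 50 * b := by rw [hbdef]; exact_mod_cast hkB
        rw [hc'] at hα'
        have : α * k ≤ 1.01 * k := by gcongr
        have hne : ∀ i, (¬ blockPart eV (T.run (G.union f w₀ eE eV fun i => some (θ i))) i
          = {G.special (θ i)}) ↔ blockPart eV (T.run (G.union f w₀ eE eV fun i => some (θ i))) i
          ≠ {G.special (θ i)} := fun i => Iff.rfl
        simp only [hne] at hcomplR
        linarith
      have hmain : b * Nat.card {θ : B → Θ // (G.union f w₀ eE eV fun i =>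
            some (θ i)).IsApproxCover α (T.run (G.union f w₀ eE eV fun i => some (θ i)))}
          ≤ 2 * ∑ i : B, (Nat.card {θ : B → Θ // blockPart eV
            (T.run (G.union f w₀ eE eV fun i => some (θ i))) i = {G.special (θ i)}} : ℝ) := by
        simp only [Nat.card_eq_fintype_card, Fintype.card_subtype, Finset.card_filter]
        push_cast
        rw [Finset.sum_comm, Finset.mul_sum, Finset.mul_sum]
        refine Finset.sum_le_sum fun θ _ => ?_
        split_ifs with hs
        · have := hsucc θ hs
          rw [Finset.card_filter] at this
          push_cast at this
          linarith
        · rw [mul_zero]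
          positivity
      have hfin : b * Nat.card {θ : B → Θ // (G.union f w₀ eE eV fun i =>
            some (θ i)).IsApproxCover α (T.run (G.union f w₀ eE eV fun i => some (θ i)))}
          ≤ b * (0.42 * N) := by
        refine (hmain.trans (mul_le_mul_of_nonneg_left hsum zero_le_two)).trans ?_
        have : (b * R / 100 / (τ + 1) + b * (τ / R) + b / 100) * N
            ≤ (b / 10 + b / 10 + b / 100) * N := by gcongr
        linarith
      have hlast := le_of_mul_le_mul_left hfin hb
      have : (100 : ℝ) * Nat.card {θ : B → Θ // (G.union f w₀ eE eV fun i =>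
            some (θ i)).IsApproxCover α (T.run (G.union f w₀ eE eV fun i => some (θ i)))}
          ≤ 98 * N := by linarith
      rw [hN] at this
      exact_mod_cast this)
  exact ⟨_, hopt θ, hθ⟩

end Gadget

/-! ### A gadget for few elements per set of the optimum -/

/-- The list `inr 0, inr 1, …` with `inr y.2` replaced by `inl y.1`. -/
def movedList {t : ℕ} (y : Fin t × Fin t) : List (Fin t ⊕ Fin t) :=
  (List.finRange t).map fun a => if a = y.2 then Sum.inl y.1 else Sum.inr a

theorem inl_mem_movedList {t : ℕ} {y : Fin t × Fin t} {a : Fin t} :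
    Sum.inl a ∈ movedList y ↔ a = y.1 := by
  simp only [movedList, List.mem_map, List.mem_finRange, true_and]
  constructor
  · rintro ⟨x, hx⟩
    split_ifs at hx
    exact (Sum.inl_injective hx).symm
  · rintro rfl
    exact ⟨y.2, by simp⟩

theorem inr_mem_movedList {t : ℕ} {y : Fin t × Fin t} {a : Fin t} :
    Sum.inr a ∈ movedList y ↔ a ≠ y.2 := by
  simp only [movedList, List.mem_map, List.mem_finRange, true_and]
  constructor
  · rintro ⟨x, hx⟩
    split_ifs at hx with h
    exact Sum.inr_injective hx ▸ h
  · exact fun h => ⟨a, by simp [h]⟩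

theorem nodup_movedList {t : ℕ} (y : Fin t × Fin t) : (movedList y).Nodup := by
  refine List.Nodup.map ?_ (List.nodup_finRange t)
  intro a a' h
  dsimp only at h
  split_ifs at h <;> simp_all

/-- Two core elements and `2 t` sets. By default `t` sets consist of the first element and the other
`t` of the second one; the secret `(a, a')` moves the second element from the set `inr a'` to the set
`inl a`. -/
def moveGadget (t : ℕ) : Gadget (Fin t ⊕ Fin t) Bool Empty (Fin t × Fin t) where
  elts
    | none, Sum.inl _ => [Sum.inl false]
    | none, Sum.inr _ => [Sum.inl true]
    | some y, Sum.inl a => if a = y.1 then [Sum.inl false, Sum.inl true] else [Sum.inl false]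
    | some y, Sum.inr a => if a = y.2 then [] else [Sum.inl true]
  sets
    | _, Sum.inl false => (List.finRange t).map Sum.inl
    | none, Sum.inl true => (List.finRange t).map Sum.inr
    | some y, Sum.inl true => movedList y
  nodup_elts := by
    rintro (_ | y) (a | a) <;> dsimp only <;> (try split_ifs) <;> simp
  nodup_sets := by
    rintro (_ | y) ((_ | _) | ⟨⟨⟩⟩)
    · exact (List.nodup_finRange t).map Sum.inl_injective
    · exact (List.nodup_finRange t).map Sum.inr_injective
    · exact (List.nodup_finRange t).map Sum.inl_injective
    · exact nodup_movedList y
  mem_iff := by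
    rintro (_ | y) (a | a) ((_ | _) | ⟨⟨⟩⟩) <;> dsimp only <;> (try split_ifs) <;>
      simp_all [inl_mem_movedList, inr_mem_movedList]
  special y := Sum.inl y.1
  core_subset := by
    rintro y (_ | _)
    · simp
    · exact inl_mem_movedList.2 rfl
  eq_special := by
    rintro y (a | a) h
    · rw [inl_mem_movedList.1 (h true)]
    · simpa using h false

theorem moveGadget_isHiding {t : ℕ} (ht : 100 ≤ t) : (moveGadget t).IsHiding t := by
  have card1 : ∀ a : Fin t, Nat.card {y : Fin t × Fin t // y.1 = a} ≤ t := fun a =>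
    (Nat.card_le_card_of_injective (fun y => y.1.2) fun y z h =>
      Subtype.ext (Prod.ext (y.2.trans z.2.symm) h)).trans_eq (Nat.card_fin t)
  have card2 : ∀ a : Fin t, Nat.card {y : Fin t × Fin t // y.2 = a} ≤ t := fun a =>
    (Nat.card_le_card_of_injective (fun y => y.1.1) fun y z h =>
      Subtype.ext (Prod.ext h (y.2.trans z.2.symm))).trans_eq (Nat.card_fin t)
  have hΘ : Fintype.card (Fin t × Fin t) = t * t := by simp
  constructor <;> rw [hΘ]
  · rintro (a | a) j
    · refine Nat.mul_le_mul_left _ ((natCard_subtype_mono fun y hy => ?_).trans (card1 a))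
      by_contra h
      exact hy (by simp [moveGadget, Ne.symm h])
    · refine Nat.mul_le_mul_left _ ((natCard_subtype_mono fun y hy => ?_).trans (card2 a))
      by_contra h
      exact hy (by simp [moveGadget, Ne.symm h])
  · rintro ((_ | _) | ⟨⟨⟩⟩) j
    · simp [moveGadget]
    · by_cases hj : j < t
      · refine Nat.mul_le_mul_left _ ((natCard_subtype_mono fun y hy => ?_).trans (card2 ⟨j, hj⟩))
        by_contra h
        exact hy (by simp [moveGadget, movedList, hj, Ne.symm h])
      · simp [moveGadget, movedList, hj]
  · rintro (a | a)
    · refine Nat.mul_le_mul ht ((natCard_subtype_mono fun y hy => ?_).trans (card1 a))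
      exact Sum.inl_injective hy
    · simp [moveGadget]

/-! ### A gadget for many elements per set of the optimum -/

section swap

variable {L t : ℕ}

/-- The default incidence relation of `swapGadget`. -/
def SwapIncident : (Fin L × Fin t) ⊕ (Fin L × Fin t) → Option (Fin L) ⊕ Fin L → Prop
  | Sum.inl a, x => x ≠ Sum.inl (some a.1)
  | Sum.inr _, x => ∃ l : Fin L, x = Sum.inl (some l)

/-- The secret `y` is about the incidence of the set `v` and the element `x`. -/
def Concerns (y : (Fin L × Fin t) × (Fin L × Fin t) × Fin L)
    (v : (Fin L × Fin t) ⊕ (Fin L × Fin t)) (x : Option (Fin L) ⊕ Fin L) : Prop :=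
  (v = Sum.inl y.1 ∨ v = Sum.inr y.2.1) ∧ (x = Sum.inl (some y.1.1) ∨ x = Sum.inr y.2.2)

/-- The permutation of the elements that the secret induces on the list of the set `v`. -/
def swapElts : Option ((Fin L × Fin t) × (Fin L × Fin t) × Fin L) →
    (Fin L × Fin t) ⊕ (Fin L × Fin t) → Equiv.Perm (Option (Fin L) ⊕ Fin L)
  | none, _ => Equiv.refl _
  | some y, v => if v = Sum.inl y.1 ∨ v = Sum.inr y.2.1 then
      Equiv.swap (Sum.inl (some y.1.1)) (Sum.inr y.2.2) else Equiv.refl _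

/-- The permutation of the sets that the secret induces on the list of the element `x`. -/
def swapSets : Option ((Fin L × Fin t) × (Fin L × Fin t) × Fin L) →
    Option (Fin L) ⊕ Fin L → Equiv.Perm ((Fin L × Fin t) ⊕ (Fin L × Fin t))
  | none, _ => Equiv.refl _
  | some y, x => if x = Sum.inl (some y.1.1) ∨ x = Sum.inr y.2.2 then
      Equiv.swap (Sum.inl y.1) (Sum.inr y.2.1) else Equiv.refl _

theorem swapElts_symm (o : Option ((Fin L × Fin t) × (Fin L × Fin t) × Fin L))
    (v : (Fin L × Fin t) ⊕ (Fin L × Fin t)) : (swapElts o v).symm = swapElts o v := by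
  cases o
  · rfl
  · simp only [swapElts]
    split_ifs <;> simp

theorem swapSets_symm (o : Option ((Fin L × Fin t) × (Fin L × Fin t) × Fin L))
    (x : Option (Fin L) ⊕ Fin L) : (swapSets (t := t) o x).symm = swapSets o x := by
  cases o
  · rfl
  · simp only [swapSets]
    split_ifs <;> simp

theorem swapElts_apply_of_not_concerns {y : (Fin L × Fin t) × (Fin L × Fin t) × Fin L}
    {v : (Fin L × Fin t) ⊕ (Fin L × Fin t)} {x : Option (Fin L) ⊕ Fin L} (h : ¬ Concerns y v x) :
    swapElts (some y) v x = x := by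
  simp only [swapElts]
  split_ifs with hv
  · obtain ⟨h1, h2⟩ := not_or.1 fun hx => h ⟨hv, hx⟩
    exact Equiv.swap_apply_of_ne_of_ne h1 h2
  · rfl

theorem swapSets_apply_of_not_concerns {y : (Fin L × Fin t) × (Fin L × Fin t) × Fin L}
    {v : (Fin L × Fin t) ⊕ (Fin L × Fin t)} {x : Option (Fin L) ⊕ Fin L} (h : ¬ Concerns y v x) :
    swapSets (some y) x v = v := by
  simp only [swapSets]
  split_ifs with hx
  · obtain ⟨h1, h2⟩ := not_or.1 fun hv => h ⟨hv, hx⟩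
    exact Equiv.swap_apply_of_ne_of_ne h1 h2
  · rfl

/-- The two lists change consistently. -/
theorem swapIncident_comm (o : Option ((Fin L × Fin t) × (Fin L × Fin t) × Fin L))
    (v : (Fin L × Fin t) ⊕ (Fin L × Fin t)) (x : Option (Fin L) ⊕ Fin L) :
    SwapIncident v (swapElts o v x) ↔ SwapIncident (swapSets o x v) x := by
  cases o with
  | none => rfl
  | some y =>
    by_cases h : Concerns y v x
    · obtain ⟨a, a', p⟩ := y
      obtain ⟨rfl | rfl, rfl | rfl⟩ := h <;> simp [swapElts, swapSets, SwapIncident]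
    · rw [swapElts_apply_of_not_concerns h, swapSets_apply_of_not_concerns h]

/-- Few secrets concern an incidence present by default: its element is padding if its set is of the
form `inl a`, and in the core if its set is of the form `inr a'`. Either way it leaves at most `L * t`
choices for the secret. -/
theorem card_concerns_le {v : (Fin L × Fin t) ⊕ (Fin L × Fin t)} {x : Option (Fin L) ⊕ Fin L}
    (h : SwapIncident v x) :
    Nat.card {y : (Fin L × Fin t) × (Fin L × Fin t) × Fin L // Concerns y v x} ≤ L * t := by
  rcases v with a | a'
  · rcases x with c | p
    · have : IsEmpty {y // Concerns y (Sum.inl a : (Fin L × Fin t) ⊕ (Fin L × Fin t))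
          (Sum.inl c)} := by
        refine ⟨fun ⟨y, h1, h2⟩ => h ?_⟩
        obtain rfl : a = y.1 := by simpa using h1
        simpa using h2
      simp
    · refine (natCard_subtype_mono (q := fun y => y.1 = a ∧ y.2.2 = p) ?_).trans
        ((Nat.card_le_card_of_injective (fun y => y.1.2.1) fun y z h => Subtype.ext
          (Prod.ext (y.2.1.trans z.2.1.symm)
            (Prod.ext h (y.2.2.trans z.2.2.symm)))).trans_eq (by simp))
      rintro y ⟨h1, h2⟩
      simp only [reduceCtorEq, false_or, or_false, Sum.inr.injEq, Sum.inl.injEq] at h1 h2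
      exact ⟨h1.symm, h2.symm⟩
  · obtain ⟨l, rfl⟩ := h
    refine (natCard_subtype_mono (q := fun y => y.1.1 = l ∧ y.2.1 = a') ?_).trans
      ((Nat.card_le_card_of_injective (fun y => (y.1.2.2, y.1.1.2)) fun y z h => Subtype.ext
        (Prod.ext (Prod.ext (y.2.1.trans z.2.1.symm) (Prod.mk.inj h).2)
          (Prod.ext (y.2.2.trans z.2.2.symm) (Prod.mk.inj h).1))).trans_eq (by simp))
    rintro y ⟨h1, h2⟩
    simp only [reduceCtorEq, false_or, or_false, Sum.inr.injEq, Sum.inl.injEq,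
      Option.some.injEq] at h1 h2
    exact ⟨h2.symm, h1.symm⟩

/-- A gadget with the core `none, some 0, …, some (L - 1)`, with `L` padding elements and with
`2 L t` sets. By default the set `inl (l, _)` contains everything except the core element `some l`,
and the set `inr _` contains the core except `none`. The secret `(a, a', p)` exchanges the padding
element `p` of the set `inl a` with the core element of `inr a'` that is missing from `inl a`, so
that `inl a` becomes special. All lists keep their lengths, and each changes in at most one
position. -/
noncomputable def swapGadget (L t : ℕ) :
    Gadget ((Fin L × Fin t) ⊕ (Fin L × Fin t)) (Option (Fin L)) (Fin L)
      ((Fin L × Fin t) × (Fin L × Fin t) × Fin L) where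
  elts o v := (Set.toFinite {x | SwapIncident v x}).toFinset.toList.map (swapElts o v)
  sets o x := (Set.toFinite {v | SwapIncident v x}).toFinset.toList.map (swapSets o x)
  nodup_elts o v := (Finset.nodup_toList _).map (swapElts o v).injective
  nodup_sets o x := (Finset.nodup_toList _).map (swapSets o x).injective
  mem_iff o v x := by
    simpa [← Equiv.eq_symm_apply, swapElts_symm, swapSets_symm] using swapIncident_comm o v x
  special y := Sum.inl y.1
  core_subset := by
    rintro ⟨a, a', p⟩ c
    simp only [List.mem_map, Finset.mem_toList, Set.Finite.mem_toFinset, Set.mem_ofPred_eq,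
      ← Equiv.eq_symm_apply, swapSets_symm, exists_eq_right]
    rw [← swapIncident_comm]
    simp only [swapElts, true_or, if_true, SwapIncident]
    rw [Ne, Equiv.swap_apply_eq_iff]
    simp
  eq_special := by
    rintro ⟨a, a', p⟩ v h
    simp only [List.mem_map, Finset.mem_toList, Set.Finite.mem_toFinset, Set.mem_ofPred_eq,
      ← Equiv.eq_symm_apply, swapSets_symm, exists_eq_right, ← swapIncident_comm] at h
    rcases v with v | v
    · by_contra hne
      have := h (some v.1)
      rw [swapElts_apply_of_not_concerns (fun hc => hne (by simpa using hc.1))] at this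
      exact this rfl
    · obtain ⟨l, hl⟩ := h none
      rw [swapElts_apply_of_not_concerns (fun hc => by simpa using hc.2)] at hl
      simp at hl

theorem swapGadget_isHiding (h : 100 ≤ L * t) : (swapGadget L t).IsHiding (L * (L * t)) := by
  have hΘ : Fintype.card ((Fin L × Fin t) × (Fin L × Fin t) × Fin L)
      = L * t * (L * t * L) := by simp
  have bound : ∀ {v : (Fin L × Fin t) ⊕ (Fin L × Fin t)} {x : Option (Fin L) ⊕ Fin L}
      (_ : SwapIncident v x) (q : (Fin L × Fin t) × (Fin L × Fin t) × Fin L → Prop),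
      (∀ y, q y → Concerns y v x) → L * (L * t) * Nat.card {y // q y} ≤ L * t * (L * t * L) := by
    intro v x hvx q hq
    calc L * (L * t) * Nat.card {y // q y} ≤ L * (L * t) * (L * t) :=
          Nat.mul_le_mul_left _ ((natCard_subtype_mono hq).trans (card_concerns_le hvx))
      _ = _ := by ring
  constructor <;> rw [hΘ]
  · intro v j
    simp only [swapGadget, List.getElem?_map]
    cases hj : (Set.toFinite {x | SwapIncident v x}).toFinset.toList[j]? with
    | none => simp
    | some x =>
      have hx : SwapIncident v x := by simpa using List.mem_of_getElem? hj
      refine bound hx _ fun y hy => ?_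
      by_contra hc
      exact hy (by rw [Option.map_some, swapElts_apply_of_not_concerns hc]; rfl)
  · intro x j
    simp only [swapGadget, List.getElem?_map]
    cases hj : (Set.toFinite {v | SwapIncident v x}).toFinset.toList[j]? with
    | none => simp
    | some v =>
      have hv : SwapIncident v x := by simpa using List.mem_of_getElem? hj
      refine bound hv _ fun y hy => ?_
      by_contra hc
      exact hy (by rw [Option.map_some, swapSets_apply_of_not_concerns hc]; rfl)
  · rintro (a | a)
    · refine Nat.mul_le_mul h ((natCard_subtype_mono
        (q := fun y : (Fin L × Fin t) × (Fin L × Fin t) × Fin L => y.1 = a)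
        fun y hy => Sum.inl_injective hy).trans ?_)
      exact (Nat.card_le_card_of_injective (fun y => y.1.2) fun y z h =>
        Subtype.ext (Prod.ext (y.2.trans z.2.symm) h)).trans_eq (by simp)
    · simp [swapGadget]

end swap

/-! ### The choice of parameters -/

/-- The lower bound from `b` copies of a hiding gadget that fit into the `n` elements and `m` sets
beside the `k - b` static sets and their private elements. -/
theorem Gadget.IsHiding.exists_requiresQueries_of_le {V K P Θ : Type} [Fintype V] [DecidableEq V]
    [Fintype K] [Fintype P] [Fintype Θ] [Nonempty K] [Nonempty Θ] {G : Gadget V K P Θ} {R : ℕ}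
    (hG : G.IsHiding R) (hR : 0 < R) {n m k b : ℕ} (hb : 0 < b) (hbk : b < k) (hkb : k ≤ 50 * b)
    (hn : b * (Fintype.card K + Fintype.card P) + (k - b) ≤ n)
    (hm : b * Fintype.card V + (k - b) ≤ m) {α : ℝ} (hα : α ≤ 1.01) (A : RandQueryAlg n m)
    (hA : ∀ I : SetCoverInstance n m, I.HasOpt k → 99 / 100 ≤ A.successProb α I) :
    ∃ I : SetCoverInstance n m, I.HasOpt k ∧ A.RequiresQueries I ((b : ℝ) * R / 100) := by
  set r := n - b * (Fintype.card K + Fintype.card P) with hr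
  set w := m - b * Fintype.card V with hw
  obtain ⟨f, hf⟩ := exists_card_image_eq (r := r) (w := w) (by omega : 0 < k - b) (by omega)
    (by omega)
  have : Nonempty (Fin b) := ⟨⟨0, hb⟩⟩
  let eE : (Fin b × (K ⊕ P)) ⊕ Fin r ≃ Fin n := Fintype.equivFinOfCardEq (by simp; omega)
  let eV : (Fin b × V) ⊕ Fin w ≃ Fin m := Fintype.equivFinOfCardEq (by simp; omega)
  have hmain := hG.exists_requiresQueries f (f ⟨0, by omega⟩) eE eV hR (by simp) (k := k)
    (by rw [hf, Fintype.card_fin]; omega) (by simpa using hkb) hα A hA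
  simpa using hmain

/-- The lower bound when there are many sets per set of the optimum. -/
theorem exists_requiresQueries_of_sets_ge {n m k : ℕ} {α : ℝ} (hα : α ≤ 1.01) (hnm : n ≤ m)
    (hk : 2 ≤ k) (hkn : 1.02 * (k : ℝ) ≤ n) (hm : 800 * k ≤ m) (A : RandQueryAlg n m)
    (hA : ∀ I : SetCoverInstance n m, I.HasOpt k → 99 / 100 ≤ A.successProb α I) :
    ∃ I : SetCoverInstance n m, I.HasOpt k ∧
      A.RequiresQueries I ((m : ℝ) * n / k / 320000) := by
  have hkn' : 51 * k ≤ 50 * n := by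
    have : (51 * k : ℝ) ≤ 50 * n := by linarith
    exact_mod_cast this
  have hkR : (0 : ℝ) < k := by positivity
  -- With `b ≥ k / 50` blocks an approximate cover cannot afford to miss half of the special sets,
  -- and `b ≤ n - k` leaves one extra element for each block.
  obtain ⟨b, hb1, hb2, hb3⟩ : ∃ b, k ≤ 50 * b ∧ b < k ∧ b ≤ n - k :=
    ⟨(k + 49) / 50, by omega, by omega, by omega⟩
  have hb1R : (k : ℝ) ≤ 50 * b := by exact_mod_cast hb1
  have weaken : ∀ R : ℕ, (m : ℝ) * n ≤ 64 * k ^ 2 * R →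
      (∃ I : SetCoverInstance n m, I.HasOpt k ∧ A.RequiresQueries I ((b : ℝ) * R / 100)) →
      ∃ I : SetCoverInstance n m, I.HasOpt k ∧ A.RequiresQueries I ((m : ℝ) * n / k / 320000) := by
    rintro R hRR ⟨I, hI, T, hT, hq⟩
    refine ⟨I, hI, T, hT, le_trans ?_ hq⟩
    rw [div_div, div_le_div_iff₀ (by positivity) (by positivity)]
    have h1 : (k : ℝ) * (k * R) ≤ 50 * b * (k * R) := by gcongr
    nlinarith
  rcases lt_or_ge n (4 * k) with hn | hn
  · obtain ⟨t, ht1, ht2⟩ : ∃ t, 4 * k * t ≤ m ∧ m < 4 * k * (t + 1) :=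
      ⟨m / (4 * k), Nat.mul_div_le _ _, Nat.lt_mul_div_succ _ (by omega)⟩
    have ht : 100 ≤ t := by
      by_contra! h
      have : 4 * k * (t + 1) ≤ 4 * k * 100 := Nat.mul_le_mul_left _ h
      omega
    have : NeZero t := ⟨by omega⟩
    refine weaken t ?_ ((moveGadget_isHiding ht).exists_requiresQueries_of_le (by omega) (by omega)
      hb2 hb1 ?_ ?_ hα A hA)
    · have h1 : (m : ℝ) ≤ 4 * k * (t + 1) := by exact_mod_cast ht2.le
      have h2 : (n : ℝ) ≤ 4 * k := by exact_mod_cast hn.le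
      have h3 : (1 : ℝ) ≤ t := by exact_mod_cast (by omega : 1 ≤ t)
      calc (m : ℝ) * n ≤ (4 * k * (t + 1)) * (4 * k) := by gcongr
        _ ≤ (4 * k * (t + t)) * (4 * k) := by gcongr
        _ = 32 * (k ^ 2 * t) := by ring
        _ ≤ 64 * (k ^ 2 * t) := by gcongr; norm_num
        _ = 64 * k ^ 2 * t := by ring
    · simp
      omega
    · simp only [Fintype.card_sum, Fintype.card_fin]
      have : b * t ≤ k * t := Nat.mul_le_mul_right _ hb2.le
      have : b * (t + t) ≤ 2 * (k * t) := by linarith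
      have : 2 * (2 * (k * t)) ≤ m := by linarith
      omega
  · obtain ⟨L, hL1, hL2⟩ : ∃ L, 4 * k * L ≤ n ∧ n < 4 * k * (L + 1) :=
      ⟨n / (4 * k), Nat.mul_div_le _ _, Nat.lt_mul_div_succ _ (by omega)⟩
    have hL : 1 ≤ L := by
      by_contra! h
      have : 4 * k * (L + 1) ≤ 4 * k * 1 := Nat.mul_le_mul_left _ h
      omega
    have hkL : 0 < 4 * k * L := by positivity
    obtain ⟨t, ht1, ht2⟩ : ∃ t, 4 * k * L * t ≤ m ∧ m < 4 * k * L * (t + 1) :=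
      ⟨m / (4 * k * L), Nat.mul_div_le _ _, Nat.lt_mul_div_succ _ hkL⟩
    have ht : 1 ≤ t := by
      by_contra! h
      have : 4 * k * L * (t + 1) ≤ 4 * k * L * 1 := Nat.mul_le_mul_left _ h
      omega
    have hm2 : m ≤ 8 * k * (L * t) := by
      calc m ≤ 4 * k * L * (t + 1) := ht2.le
        _ ≤ 4 * k * L * (t + t) := by gcongr
        _ = 8 * k * (L * t) := by ring
    have hn2 : n ≤ 8 * k * L := by
      calc n ≤ 4 * k * (L + 1) := hL2.le
        _ ≤ 4 * k * (L + L) := by gcongr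
        _ = 8 * k * L := by ring
    have hLt : 100 ≤ L * t := by
      by_contra! h
      have : 8 * k * (L * t) ≤ 8 * k * 99 := Nat.mul_le_mul_left _ (by omega)
      omega
    have : NeZero t := ⟨by omega⟩
    have : NeZero L := ⟨by omega⟩
    refine weaken (L * (L * t)) ?_ ((swapGadget_isHiding hLt).exists_requiresQueries_of_le
      (by positivity) (by omega) hb2 hb1 ?_ ?_ hα A hA)
    · have h1 : (m : ℝ) ≤ 8 * k * (L * t) := by exact_mod_cast hm2
      have h2 : (n : ℝ) ≤ 8 * k * L := by exact_mod_cast hn2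
      push_cast
      calc (m : ℝ) * n ≤ (8 * k * (L * t)) * (8 * k * L) := by gcongr
        _ = 64 * k ^ 2 * (L * (L * t)) := by ring
    · simp only [Fintype.card_option, Fintype.card_fin]
      have h1 : b * L ≤ k * L := Nat.mul_le_mul_right _ hb2.le
      have h2 : b * (L + 1 + L) = 2 * (b * L) + b := by ring
      have h3 : 4 * (k * L) ≤ n := by linarith
      omega
    · simp only [Fintype.card_sum, Fintype.card_prod, Fintype.card_fin]
      have h1 : b * (L * t) ≤ k * (L * t) := Nat.mul_le_mul_right _ hb2.le
      have h2 : b * (L * t + L * t) = 2 * (b * (L * t)) := by ring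
      have h3 : 4 * (k * (L * t)) ≤ m := by linarith
      omega

theorem theorem3p4 :
    ∃ p : ℕ, ∀ C : ℝ, 0 < C → ∃ c : ℝ, 0 < c ∧
      ∀ (n m k : ℕ) (α : ℝ), α ≤ 1.01 → n ≤ m → 2 ≤ k → 1.02 * (k : ℝ) ≤ (n : ℝ) →
        (k : ℝ) ≤ C * ((m : ℝ) / Real.log (n : ℝ)) →
        ∀ A : RandQueryAlg n m,
          (∀ I : SetCoverInstance n m, I.HasOpt k → 99 / 100 ≤ A.successProb α I) →
          ∃ I : SetCoverInstance n m, I.HasOpt k ∧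
            A.RequiresQueries I
              (c * ((m : ℝ) * (n : ℝ) / (k : ℝ)) / Real.log ((m : ℝ) * (n : ℝ)) ^ p) := by
  refine ⟨0, fun C hC => ⟨min (1 / 320000) (1 / (800 * Real.exp (800 * C))), by positivity, ?_⟩⟩
  intro n m k α hα hnm hk hkn hkm A hA
  simp only [pow_zero, div_one]
  have hkR : (2 : ℝ) ≤ k := by exact_mod_cast hk
  have hn : (1 : ℝ) < n := by linarith
  have hlog : 0 < Real.log n := Real.log_pos hn
  rcases le_or_gt (800 * k) m with hm | hm
  · obtain ⟨I, hI, T, hT, hq⟩ := exists_requiresQueries_of_sets_ge hα hnm hk hkn hm A hA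
    refine ⟨I, hI, T, hT, le_trans ?_ hq⟩
    calc min (1 / 320000) (1 / (800 * Real.exp (800 * C))) * ((m : ℝ) * n / k)
        ≤ 1 / 320000 * ((m : ℝ) * n / k) := by
          gcongr
          exact min_le_left _ _
      _ = (m : ℝ) * n / k / 320000 := by ring
  · -- Here `n` is bounded in terms of `C`, and the bound asks for one query only.
    obtain ⟨I, hI, T, hT, hq⟩ := exists_requiresQueries_one hα hnm hk hkn A hA
    refine ⟨I, hI, T, hT, le_trans ?_ hq⟩
    have hmR : (m : ℝ) ≤ 800 * k := by exact_mod_cast hm.le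
    have hk0 : (0 : ℝ) < k := by linarith
    have hlogle : Real.log n ≤ 800 * C := by
      rw [← mul_div_assoc, le_div_iff₀ hlog] at hkm
      refine le_of_mul_le_mul_left (hkm.trans ?_) hk0
      nlinarith
    have hnle : (n : ℝ) ≤ Real.exp (800 * C) := (Real.log_le_iff_le_exp (by linarith)).1 hlogle
    have hdiv : (m : ℝ) * n / k ≤ 800 * Real.exp (800 * C) := by
      rw [div_le_iff₀ hk0]
      calc (m : ℝ) * n ≤ 800 * k * Real.exp (800 * C) := by gcongr
        _ = _ := by ring
    calc min (1 / 320000) (1 / (800 * Real.exp (800 * C))) * ((m : ℝ) * n / k)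
        ≤ 1 / (800 * Real.exp (800 * C)) * (800 * Real.exp (800 * C)) := by
          gcongr
          exact min_le_right _ _
      _ = 1 := by field_simp
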